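/- Let $\tfrac12\le H_1<H_2<1$ and $T>0$. Put $\beta_{H_2}=\Bigl(\frac{H_2(2H_2-1)}{\mathrm B(H_2-1/2,\,2-2H_2)}\Bigr)^{1/2}$, where $\mathrm B$ is the Euler beta function, and for $0<s<t$ let $$K(t,s)=\beta_{H_2}\,s^{1/2-H_2}\int_s^t (t-u)^{1/2-H_1}u^{H_2-H_1}(u-s)^{H_2-3/2}\,du .$$ For $s,u\in[0,T]$ let $$k(s,u)=\int_0^{s\wedge u}\partial_sK(s,v)\,\partial_uK(u,v)\,dv,\qquad \kappa(s,u)=u^{2H_1-1}k(s,u).$$ The integral defining $K(t,s)$ converges and $K(\cdot,s)$ is differentiable at $t$ for $0<s<t\le T$, and the integral defining $k(s,u)$ converges absolutely for all $s,u\in(0,T]$ with $s\ne u$. Moreover, there is a function $\kappa_0:[0,T]^2\to\mathbb R$ that is bounded, and continuous on $[0,T]^2\setminus\{(0,0)\}$, such that for Lebesgue-almost every $(s,u)\in[0,T]^2$ $$\kappa(s,u)=\begin{cases}\kappa_0(s,u)\,\varphi(s,u), & s\neq u,\\ 0, & s=u,\end{cases}\qquad \varphi(s,u)=(s\wedge u)^{1-2H_1}\,u^{2H_1-1}\,|s-u|^{2H_2-2H_1-1}.$$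 -/

import Mathlib

open MeasureTheory

/-- The constant `β_H = (H (2H - 1) / B(H - 1/2, 2 - 2H))^{1/2}`, with `B` the Euler beta function
(both arguments are positive for `1/2 < H < 1`). -/
noncomputable def betaConst (H : ℝ) : ℝ :=
  Real.sqrt (H * (2 * H - 1) / ProbabilityTheory.beta (H - 1 / 2) (2 - 2 * H))

/-- The integrand `u ↦ (t - u)^{1/2 - H₁} u^{H₂ - H₁} (u - s)^{H₂ - 3/2}`, `s < u < t`. -/
noncomputable def bigKIntegrand (H₁ H₂ t s u : ℝ) : ℝ :=
  (t - u) ^ (1 / 2 - H₁) * u ^ (H₂ - H₁) * (u - s) ^ (H₂ - 3 / 2)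

/-- The kernel `K_{H₁,H₂}(t,s) = β_{H₂} s^{1/2 - H₂} ∫_s^t (t-u)^{1/2-H₁} u^{H₂-H₁} (u-s)^{H₂-3/2} du`,
`0 < s < t`. -/
noncomputable def bigK (H₁ H₂ t s : ℝ) : ℝ :=
  betaConst H₂ * s ^ (1 / 2 - H₂) * ∫ u in s..t, bigKIntegrand H₁ H₂ t s u

/-- The partial derivative `∂_t K_{H₁,H₂}(t,s)` in the first variable. -/
noncomputable def dBigK (H₁ H₂ t s : ℝ) : ℝ :=
  deriv (fun x => bigK H₁ H₂ x s) t

/-- `k(s,u) = ∫_0^{s ∧ u} ∂_s K_{H₁,H₂}(s,v) ∂_u K_{H₁,H₂}(u,v) dv`. -/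
noncomputable def smallK (H₁ H₂ s u : ℝ) : ℝ :=
  ∫ v in (0 : ℝ)..(min s u), dBigK H₁ H₂ s v * dBigK H₁ H₂ u v

/-- `κ(s,u) = u^{2H₁ - 1} k(s,u)`. -/
noncomputable def kappa (H₁ H₂ s u : ℝ) : ℝ :=
  u ^ (2 * H₁ - 1) * smallK H₁ H₂ s u

/-- `φ(s,u) = (s ∧ u)^{1 - 2H₁} u^{2H₁ - 1} |s - u|^{2H₂ - 2H₁ - 1}`. -/
noncomputable def phi (H₁ H₂ s u : ℝ) : ℝ :=
  (min s u) ^ (1 - 2 * H₁) * u ^ (2 * H₁ - 1) * |s - u| ^ (2 * H₂ - 2 * H₁ - 1)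

/-! Write `h = H₂ - H₁`, so `0 < h < 1/2`. Rescaling the integral for `K(t,s)` to `[0,1]` moves the
`t`-dependence out of the singular factors, and differentiation gives `∂_t K(t,s) = β h s^(1/2-H₂)
(t-s)^(h-1) t^h G(s/t)` with `G = kernelProfile` continuous on `[0,1]`. For `s < u` and `r = s/u`,
the substitution `v = s w` then turns `k(s,u)` into `(β h)² s^(1-2H₁) u^(2h-1)` times `I(r) = ∫₀¹
w^(1-2H₂) (1-w)^(h-1) (1-rw)^(h-1) G(w) G(rw) dw`. The crux is `r → 1`: blowing up at scale `1 - r`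
around `w = 1` shows that `(1-r)^(1-2h) I(r)` has a limit, hence extends to a continuous `f` on
`[0,1]` (`exists_continuousOn_eq_overlap`). The remaining powers are those of `φ`, and `κ₀` is a
constant times `f(min/max)`; symmetry of `k` covers `s > u`. -/

/-- The Euler beta weight is integrable on `[0, 1]` when both exponents exceed `-1`. -/
theorem intervalIntegrable_rpow_mul_one_sub_rpow {p q : ℝ} (hp : -1 < p) (hq : -1 < q) :
    IntervalIntegrable (fun x : ℝ => x ^ p * (1 - x) ^ q) volume 0 1 := by
  -- The reflection `x ↦ 1 - x` swaps the exponents, so only the singularity at `0` needs treatment.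
  have key : ∀ {p q : ℝ}, -1 < p →
      IntervalIntegrable (fun x : ℝ => x ^ p * (1 - x) ^ q) volume 0 (1 / 2) := by
    intro p q hp
    refine (intervalIntegral.intervalIntegrable_rpow' hp).mul_continuousOn ?_
    refine ContinuousOn.rpow_const (by fun_prop) fun x hx => Or.inl ?_
    rw [Set.uIcc_of_le (by norm_num)] at hx
    linarith [hx.2]
  refine (key hp).trans ?_
  have h := ((key (q := p) hq).comp_sub_left 1).symm
  convert h using 2
  · rw [sub_sub_cancel]; ring
  · norm_num
  · norm_num

/-! ### The kernel `K` and its derivative -/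

/-- The integral over `[0, 1]` obtained from the partial derivative of the kernel by rescaling to
the unit interval. -/
noncomputable def kernelProfile (H₁ H₂ r : ℝ) : ℝ :=
  ∫ x in (0 : ℝ)..1, x ^ (H₂ - 3 / 2) * (1 - x) ^ (1 / 2 - H₁) *
    ((r + (1 - r) * x) ^ (H₂ - H₁) + (1 - r) * x * (r + (1 - r) * x) ^ (H₂ - H₁ - 1))

/-- Since `(1-r)x ≤ r + (1-r)x ≤ 1`, each summand of the bracket is at most `1`. Twice the beta
weight therefore dominates uniformly, down to `r = 0`. -/
theorem continuousOn_kernelProfile {H₁ H₂ : ℝ} (hH₁ : H₁ < 3 / 2) (hH₂ : 1 / 2 < H₂)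
    (hH : H₁ < H₂) : ContinuousOn (kernelProfile H₁ H₂) (Set.Icc 0 1) := by
  intro r₀ hr₀
  have hW := intervalIntegrable_rpow_mul_one_sub_rpow
    (p := H₂ - 3 / 2) (q := 1 / 2 - H₁) (by linarith) (by linarith)
  refine intervalIntegral.continuousWithinAt_of_dominated_interval
    (bound := fun x => x ^ (H₂ - 3 / 2) * (1 - x) ^ (1 / 2 - H₁) * 2) ?_ ?_ (hW.mul_const 2) ?_
  · exact Filter.Eventually.of_forall fun r => Measurable.aestronglyMeasurable (by fun_prop)
  · filter_upwards [self_mem_nhdsWithin] with r hr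
    refine Filter.Eventually.of_forall fun x hx => ?_
    rw [Set.uIoc_of_le zero_le_one] at hx
    obtain ⟨hx0, hx1⟩ := hx
    obtain ⟨hr0, hr1⟩ := hr
    have h1 : 0 ≤ x ^ (H₂ - 3 / 2) * (1 - x) ^ (1 / 2 - H₁) :=
      mul_nonneg (Real.rpow_nonneg hx0.le _) (Real.rpow_nonneg (by linarith) _)
    have hw0 : 0 < r + (1 - r) * x := by nlinarith
    have hw1 : r + (1 - r) * x ≤ 1 := by nlinarith
    have h2 : (r + (1 - r) * x) ^ (H₂ - H₁) ≤ 1 := Real.rpow_le_one hw0.le hw1 (by linarith)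
    have h3 : (1 - r) * x * (r + (1 - r) * x) ^ (H₂ - H₁ - 1) ≤ (r + (1 - r) * x) ^ (H₂ - H₁) := by
      rw [Real.rpow_sub_one hw0.ne', mul_div_assoc', div_le_iff₀ hw0, mul_comm]
      exact mul_le_mul_of_nonneg_left (by linarith) (Real.rpow_nonneg hw0.le _)
    have h4 : 0 ≤ (1 - r) * x * (r + (1 - r) * x) ^ (H₂ - H₁ - 1) :=
      mul_nonneg (mul_nonneg (by linarith) hx0.le) (Real.rpow_nonneg hw0.le _)
    have h5 : 0 ≤ (r + (1 - r) * x) ^ (H₂ - H₁) := Real.rpow_nonneg hw0.le _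
    rw [norm_mul, Real.norm_of_nonneg h1, Real.norm_of_nonneg (by linarith)]
    exact mul_le_mul_of_nonneg_left (by linarith) h1
  · refine Filter.Eventually.of_forall fun x hx => ContinuousAt.continuousWithinAt ?_
    rw [Set.uIoc_of_le zero_le_one] at hx
    have hw0 : r₀ + (1 - r₀) * x ≠ 0 := by nlinarith [hx.1, hx.2, hr₀.1, hr₀.2]
    refine continuousAt_const.mul (ContinuousAt.add ?_ (ContinuousAt.mul (by fun_prop) ?_)) <;>
    exact ContinuousAt.rpow_const (by fun_prop) (Or.inl hw0)

/-- Rescaling the integrand of the kernel to the unit interval. -/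
theorem bigKIntegrand_add_mul {H₁ H₂ t s x : ℝ} (hst : s < t) (hx : x ∈ Set.Icc (0 : ℝ) 1) :
    bigKIntegrand H₁ H₂ t s (s + (t - s) * x) = (t - s) ^ (H₂ - H₁ - 1) *
      (x ^ (H₂ - 3 / 2) * (1 - x) ^ (1 / 2 - H₁) * (s + (t - s) * x) ^ (H₂ - H₁)) := by
  have h0 : 0 < t - s := sub_pos.2 hst
  have e : (t - s) ^ (H₂ - H₁ - 1) = (t - s) ^ (1 / 2 - H₁) * (t - s) ^ (H₂ - 3 / 2) := by
    rw [← Real.rpow_add h0]; ring_nf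
  rw [bigKIntegrand, show t - (s + (t - s) * x) = (t - s) * (1 - x) by ring,
    show s + (t - s) * x - s = (t - s) * x by ring, Real.mul_rpow h0.le (by linarith [hx.2]),
    Real.mul_rpow h0.le hx.1, e]
  ring

theorem IntervalIntegrable.of_comp_add_mul {f : ℝ → ℝ} {s t : ℝ} (hst : s < t)
    (hf : IntervalIntegrable (fun x => f (s + (t - s) * x)) volume 0 1) :
    IntervalIntegrable f volume s t := by
  have h0 : t - s ≠ 0 := (sub_pos.2 hst).ne'
  have h1 : IntervalIntegrable (fun x => f (s + x)) volume 0 (t - s) := by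
    rw [← IntervalIntegrable.comp_mul_left_iff h0, zero_div, div_self h0]
    exact hf
  rw [← IntervalIntegrable.comp_add_left_iff (c := s), sub_self]
  exact h1

theorem intervalIntegrable_bigK_rescaled {H₁ H₂ t s : ℝ} (hH₁ : H₁ < 3 / 2) (hH₂ : 1 / 2 < H₂)
    (hs : 0 < s) (hst : s < t) (p : ℝ) :
    IntervalIntegrable (fun x => x ^ (H₂ - 3 / 2) * (1 - x) ^ (1 / 2 - H₁) *
      (s + (t - s) * x) ^ p) volume 0 1 := by
  refine (intervalIntegrable_rpow_mul_one_sub_rpow (by linarith) (by linarith)).mul_continuousOn ?_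
  refine ContinuousOn.rpow_const (by fun_prop) fun x hx => Or.inl ?_
  rw [Set.uIcc_of_le zero_le_one] at hx
  nlinarith [hx.1]

theorem intervalIntegrable_bigKIntegrand {H₁ H₂ t s : ℝ} (hH₁ : H₁ < 3 / 2) (hH₂ : 1 / 2 < H₂)
    (hs : 0 < s) (hst : s < t) : IntervalIntegrable (bigKIntegrand H₁ H₂ t s) volume s t := by
  refine .of_comp_add_mul hst ?_
  refine ((intervalIntegrable_bigK_rescaled hH₁ hH₂ hs hst (H₂ - H₁)).const_mul
    ((t - s) ^ (H₂ - H₁ - 1))).congr fun x hx => ?_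
  rw [Set.uIoc_of_le zero_le_one] at hx
  exact (bigKIntegrand_add_mul hst ⟨hx.1.le, hx.2⟩).symm

theorem bigK_eq {H₁ H₂ t s : ℝ} (hst : s < t) :
    bigK H₁ H₂ t s = betaConst H₂ * s ^ (1 / 2 - H₂) * ((t - s) ^ (H₂ - H₁) *
      ∫ x in (0 : ℝ)..1, x ^ (H₂ - 3 / 2) * (1 - x) ^ (1 / 2 - H₁) *
        (s + (t - s) * x) ^ (H₂ - H₁)) := by
  have h0 : 0 < t - s := sub_pos.2 hst
  have h := intervalIntegral.mul_integral_comp_add_mul (a := 0) (b := 1)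
    (f := bigKIntegrand H₁ H₂ t s) (t - s) s
  rw [show s + (t - s) * 0 = s by ring, show s + (t - s) * 1 = t by ring] at h
  have h2 : ∫ x in (0 : ℝ)..1, bigKIntegrand H₁ H₂ t s (s + (t - s) * x) =
      ∫ x in (0 : ℝ)..1, (t - s) ^ (H₂ - H₁ - 1) *
      (x ^ (H₂ - 3 / 2) * (1 - x) ^ (1 / 2 - H₁) * (s + (t - s) * x) ^ (H₂ - H₁)) := by
    refine intervalIntegral.integral_congr fun x hx => ?_
    rw [Set.uIcc_of_le zero_le_one] at hx
    exact bigKIntegrand_add_mul hst hx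
  rw [bigK, ← h, h2, intervalIntegral.integral_const_mul, ← mul_assoc (t - s),
    Real.rpow_sub_one h0.ne' (H₂ - H₁), mul_div_cancel₀ _ h0.ne']

/-- After rescaling, only the smooth factor depends on `t`. Its base stays at least `s > 0`, and the
exponent `H₂ - H₁ - 1` is negative, so its value at `s` dominates. -/
theorem hasDerivAt_integral_rescaled {H₁ H₂ t s : ℝ} (hH₁ : H₁ < 3 / 2) (hH₂ : 1 / 2 < H₂)
    (hH : H₁ < H₂) (hH' : H₂ - H₁ < 1) (hs : 0 < s) (hst : s < t) :
    HasDerivAt (fun t => ∫ x in (0 : ℝ)..1, x ^ (H₂ - 3 / 2) * (1 - x) ^ (1 / 2 - H₁) *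
        (s + (t - s) * x) ^ (H₂ - H₁))
      (∫ x in (0 : ℝ)..1, x ^ (H₂ - 3 / 2) * (1 - x) ^ (1 / 2 - H₁) *
        (x * (H₂ - H₁) * (s + (t - s) * x) ^ (H₂ - H₁ - 1))) t := by
  have hW := intervalIntegrable_rpow_mul_one_sub_rpow
    (p := H₂ - 3 / 2) (q := 1 / 2 - H₁) (by linarith) (by linarith)
  refine (intervalIntegral.hasDerivAt_integral_of_dominated_loc_of_deriv_le
    (F' := fun t x => x ^ (H₂ - 3 / 2) * (1 - x) ^ (1 / 2 - H₁) *
        (x * (H₂ - H₁) * (s + (t - s) * x) ^ (H₂ - H₁ - 1)))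
    (bound := fun x => x ^ (H₂ - 3 / 2) * (1 - x) ^ (1 / 2 - H₁) *
      ((H₂ - H₁) * s ^ (H₂ - H₁ - 1)))
    (Ioi_mem_nhds hst) ?_ (intervalIntegrable_bigK_rescaled hH₁ hH₂ hs hst _) ?_ ?_
    (hW.mul_const _) ?_).2
  · exact Filter.Eventually.of_forall fun r => Measurable.aestronglyMeasurable (by fun_prop)
  · exact Measurable.aestronglyMeasurable (by fun_prop)
  · refine Filter.Eventually.of_forall fun x hx y hy => ?_
    rw [Set.uIoc_of_le zero_le_one] at hx
    obtain ⟨hx0, hx1⟩ := hx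
    have hy : s < y := hy
    have h1 : 0 ≤ x ^ (H₂ - 3 / 2) * (1 - x) ^ (1 / 2 - H₁) :=
      mul_nonneg (Real.rpow_nonneg hx0.le _) (Real.rpow_nonneg (by linarith) _)
    have hw : s ≤ s + (y - s) * x := by nlinarith
    have hh : 0 < H₂ - H₁ := sub_pos.2 hH
    have h2 : (s + (y - s) * x) ^ (H₂ - H₁ - 1) ≤ s ^ (H₂ - H₁ - 1) :=
      Real.rpow_le_rpow_of_nonpos hs hw (by linarith)
    have h3 : 0 ≤ (s + (y - s) * x) ^ (H₂ - H₁ - 1) := Real.rpow_nonneg (by linarith) _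
    rw [norm_mul, Real.norm_of_nonneg h1, Real.norm_of_nonneg (by positivity)]
    refine mul_le_mul_of_nonneg_left (mul_le_mul ?_ h2 h3 hh.le) h1
    nlinarith
  · refine Filter.Eventually.of_forall fun x hx y hy => HasDerivAt.const_mul _ ?_
    rw [Set.uIoc_of_le zero_le_one] at hx
    have hy : s < y := hy
    have hw : s + (y - s) * x ≠ 0 := by nlinarith [hx.1]
    have h : HasDerivAt (fun y => s + (y - s) * x) x y := by
      simpa using (((hasDerivAt_id y).sub_const s).mul_const x).const_add s
    exact h.rpow_const (Or.inl hw)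

/-- The two terms of the product rule for `∂_t K` combine into an expression homogeneous of degree
`H₂ - H₁` in `(s,t)`. -/
theorem kernelProfile_rescaled {H₁ H₂ t s : ℝ} (hH₁ : H₁ < 3 / 2) (hH₂ : 1 / 2 < H₂)
    (hs : 0 < s) (hst : s < t) :
    (∫ x in (0 : ℝ)..1, x ^ (H₂ - 3 / 2) * (1 - x) ^ (1 / 2 - H₁) *
        (s + (t - s) * x) ^ (H₂ - H₁)) +
      (t - s) * ∫ x in (0 : ℝ)..1, x ^ (H₂ - 3 / 2) * (1 - x) ^ (1 / 2 - H₁) *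
        (x * (s + (t - s) * x) ^ (H₂ - H₁ - 1)) =
      t ^ (H₂ - H₁) * kernelProfile H₁ H₂ (s / t) := by
  have ht : 0 < t := hs.trans hst
  have hi := ((intervalIntegrable_bigK_rescaled hH₁ hH₂ hs hst (H₂ - H₁ - 1)).mul_continuousOn
    (continuousOn_id)).const_mul (t - s)
  have hi' : IntervalIntegrable (fun x => (t - s) * (x ^ (H₂ - 3 / 2) * (1 - x) ^ (1 / 2 - H₁) *
        (x * (s + (t - s) * x) ^ (H₂ - H₁ - 1)))) volume 0 1 := by
    refine hi.congr fun x _ => ?_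
    simp only [id]; ring
  rw [kernelProfile, ← intervalIntegral.integral_const_mul, ← intervalIntegral.integral_const_mul,
    ← intervalIntegral.integral_add (intervalIntegrable_bigK_rescaled hH₁ hH₂ hs hst _) hi']
  refine intervalIntegral.integral_congr fun x hx => ?_
  rw [Set.uIcc_of_le zero_le_one] at hx
  have e : s + (t - s) * x = t * (s / t + (1 - s / t) * x) := by field_simp
  have hr : s / t < 1 := (div_lt_one ht).2 hst
  have hr0 : 0 < s / t := div_pos hs ht
  have hw : 0 ≤ s / t + (1 - s / t) * x := by nlinarith [hx.1]
  have e2 : t - s = t * (1 - s / t) := by field_simp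
  simp only [e]
  rw [Real.mul_rpow ht.le hw, Real.mul_rpow ht.le hw, Real.rpow_sub_one ht.ne', e2]
  field_simp

theorem hasDerivAt_bigK {H₁ H₂ t s : ℝ} (hH₁ : H₁ < 3 / 2) (hH₂ : 1 / 2 < H₂)
    (hH : H₁ < H₂) (hH' : H₂ - H₁ < 1) (hs : 0 < s) (hst : s < t) :
    HasDerivAt (fun t => bigK H₁ H₂ t s)
      (betaConst H₂ * (H₂ - H₁) * s ^ (1 / 2 - H₂) * (t - s) ^ (H₂ - H₁ - 1) *
        (t ^ (H₂ - H₁) * kernelProfile H₁ H₂ (s / t))) t := by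
  have h0 : 0 < t - s := sub_pos.2 hst
  have h1 : HasDerivAt (fun t => (t - s) ^ (H₂ - H₁))
      (1 * (H₂ - H₁) * (t - s) ^ (H₂ - H₁ - 1)) t :=
    ((hasDerivAt_id t).sub_const s).rpow_const (Or.inl h0.ne')
  have h2 := (h1.mul (hasDerivAt_integral_rescaled hH₁ hH₂ hH hH' hs hst)).const_mul
    (betaConst H₂ * s ^ (1 / 2 - H₂))
  refine (h2.congr_of_eventuallyEq (Filter.eventually_of_mem (Ioi_mem_nhds hst)
    fun x hx => bigK_eq hx)).congr_deriv ?_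
  have e : ∫ x in (0 : ℝ)..1, x ^ (H₂ - 3 / 2) * (1 - x) ^ (1 / 2 - H₁) *
        (x * (H₂ - H₁) * (s + (t - s) * x) ^ (H₂ - H₁ - 1)) =
      (H₂ - H₁) * ∫ x in (0 : ℝ)..1, x ^ (H₂ - 3 / 2) * (1 - x) ^ (1 / 2 - H₁) *
        (x * (s + (t - s) * x) ^ (H₂ - H₁ - 1)) := by
    rw [← intervalIntegral.integral_const_mul]
    refine intervalIntegral.integral_congr fun x _ => ?_
    ring
  rw [← kernelProfile_rescaled hH₁ hH₂ hs hst, e, Real.rpow_sub_one h0.ne' (H₂ - H₁)]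
  field_simp

/-! ### The overlap integral and its diagonal limit -/

/-- The integrand of the scale-invariant part of the kernel `k`. -/
noncomputable def overlapIntegrand (α h : ℝ) (g : ℝ → ℝ) (r w : ℝ) : ℝ :=
  w ^ α * (1 - w) ^ (h - 1) * ((1 - r * w) ^ (h - 1) * (g w * g (r * w)))

theorem measurable_overlapIntegrand {α h : ℝ} {g : ℝ → ℝ} (hg : Continuous g) (r : ℝ) :
    Measurable (overlapIntegrand α h g r) := by
  have := hg.measurable
  unfold overlapIntegrand
  fun_prop

theorem intervalIntegrable_overlapIntegrand {α h : ℝ} {g : ℝ → ℝ} (hα : -1 < α) (hh : 0 < h)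
    (hg : Continuous g) {r : ℝ} (hr0 : 0 ≤ r) (hr1 : r < 1) :
    IntervalIntegrable (overlapIntegrand α h g r) volume 0 1 := by
  refine (intervalIntegrable_rpow_mul_one_sub_rpow hα (by linarith)).mul_continuousOn
    (ContinuousOn.mul ?_ (by fun_prop))
  refine ContinuousOn.rpow_const (by fun_prop) fun x hx => Or.inl ?_
  rw [Set.uIcc_of_le zero_le_one] at hx
  nlinarith [hx.1, hx.2]

/-- The condition `ρ * c < 1` keeps `1 - r w` away from `0`. It covers both `r` away from `1` with
`c = 1`, and `r` up to `1` with `c = 1/2`. -/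
theorem continuousOn_integral_overlapIntegrand {α h M c ρ : ℝ} {g : ℝ → ℝ} (hα : -1 < α)
    (hh : 0 < h) (hh1 : h < 1) (hg : Continuous g) (hM : ∀ x, |g x| ≤ M) (hc0 : 0 ≤ c)
    (hc1 : c ≤ 1) (hρ : ρ * c < 1) :
    ContinuousOn (fun r => ∫ w in (0 : ℝ)..c, overlapIntegrand α h g r w) (Set.Icc 0 ρ) := by
  intro r₀ hr₀
  have hlow : ∀ r ∈ Set.Icc 0 ρ, ∀ x ∈ Set.Ioc 0 c, 1 - ρ * c ≤ 1 - r * x := fun r hr x hx => by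
    have := mul_le_mul hr.2 hx.2 hx.1.le (hr.1.trans hr.2)
    linarith
  refine intervalIntegral.continuousWithinAt_of_dominated_interval
    (bound := fun x => x ^ α * (1 - x) ^ (h - 1) * ((1 - ρ * c) ^ (h - 1) * (M * M))) ?_ ?_ ?_ ?_
  · exact Filter.Eventually.of_forall fun r =>
      (measurable_overlapIntegrand hg r).aestronglyMeasurable
  · filter_upwards [self_mem_nhdsWithin] with r hr
    refine Filter.Eventually.of_forall fun x hx => ?_
    rw [Set.uIoc_of_le hc0] at hx
    have hl := hlow r hr x hx
    have h1 : 0 ≤ x ^ α * (1 - x) ^ (h - 1) :=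
      mul_nonneg (Real.rpow_nonneg hx.1.le _) (Real.rpow_nonneg (by linarith [hx.2]) _)
    have h2 : (1 - r * x) ^ (h - 1) ≤ (1 - ρ * c) ^ (h - 1) :=
      Real.rpow_le_rpow_of_nonpos (by linarith) hl (by linarith)
    have h3 : 0 ≤ (1 - r * x) ^ (h - 1) := Real.rpow_nonneg (by linarith) _
    rw [overlapIntegrand, norm_mul, Real.norm_of_nonneg h1, norm_mul, Real.norm_of_nonneg h3,
      norm_mul, Real.norm_eq_abs, Real.norm_eq_abs]
    exact mul_le_mul_of_nonneg_left (mul_le_mul h2 (mul_le_mul (hM _) (hM _) (abs_nonneg _)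
      ((abs_nonneg _).trans (hM x))) (by positivity) (h3.trans h2)) h1
  · refine ((intervalIntegrable_rpow_mul_one_sub_rpow hα (by linarith)).mono_set ?_).mul_const _
    rw [Set.uIcc_of_le hc0, Set.uIcc_of_le zero_le_one]
    exact Set.Icc_subset_Icc_right hc1
  · refine Filter.Eventually.of_forall fun x hx => ContinuousAt.continuousWithinAt ?_
    rw [Set.uIoc_of_le hc0] at hx
    have hl := hlow r₀ hr₀ x hx
    refine continuousAt_const.mul (ContinuousAt.mul ?_ (by fun_prop))
    exact ContinuousAt.rpow_const (by fun_prop) (Or.inl (by linarith))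

/-- Dominating function for the blow-up: of order `y^(h-1)` at `0` and `y^(2h-2)` at infinity, where
`h < 1/2` is needed. -/
theorem integrableOn_rpow_mul_one_add_half_rpow {h : ℝ} (hh : 0 < h) (hh2 : h < 1 / 2) :
    IntegrableOn (fun y : ℝ => y ^ (h - 1) * (1 + y / 2) ^ (h - 1)) (Set.Ioi 0) := by
  rw [← Set.Ioc_union_Ioi_eq_Ioi zero_le_one]
  have hm : Measurable (fun y : ℝ => y ^ (h - 1) * (1 + y / 2) ^ (h - 1)) := by fun_prop
  refine IntegrableOn.union ?_ ?_
  · have h1 : IntegrableOn (fun y : ℝ => y ^ (h - 1)) (Set.Ioc 0 1) :=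
      (intervalIntegrable_iff_integrableOn_Ioc_of_le zero_le_one).1
        (intervalIntegral.intervalIntegrable_rpow' (by linarith))
    refine h1.mono' hm.aestronglyMeasurable ?_
    refine (ae_restrict_iff' measurableSet_Ioc).2 (Filter.Eventually.of_forall fun y hy => ?_)
    have h2 : 0 ≤ y ^ (h - 1) := Real.rpow_nonneg hy.1.le _
    have h3 : 0 ≤ (1 + y / 2) ^ (h - 1) := Real.rpow_nonneg (by linarith [hy.1]) _
    rw [Real.norm_of_nonneg (by positivity)]
    exact mul_le_of_le_one_right h2
      (Real.rpow_le_one_of_one_le_of_nonpos (by linarith [hy.1]) (by linarith))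
  · have h1 : IntegrableOn (fun y : ℝ => y ^ (2 * h - 2) * (1 / 2) ^ (h - 1)) (Set.Ioi 1) :=
      (integrableOn_Ioi_rpow_of_lt (by linarith) zero_lt_one).mul_const _
    refine h1.mono' hm.aestronglyMeasurable ?_
    refine (ae_restrict_iff' measurableSet_Ioi).2 (Filter.Eventually.of_forall fun y hy => ?_)
    have hy0 : 0 < y := zero_lt_one.trans hy
    have h2 : 0 ≤ y ^ (h - 1) := Real.rpow_nonneg hy0.le _
    have h3 : 0 ≤ (1 + y / 2) ^ (h - 1) := Real.rpow_nonneg (by linarith) _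
    rw [Real.norm_of_nonneg (by positivity), show 2 * h - 2 = (h - 1) + (h - 1) by ring,
      Real.rpow_add hy0, mul_assoc, 
      ← Real.mul_rpow hy0.le (show (0 : ℝ) ≤ 1 / 2 by norm_num)]
    exact mul_le_mul_of_nonneg_left
      (Real.rpow_le_rpow_of_nonpos (by linarith) (by linarith) (by linarith)) h2

/-- The integrand of the scale-invariant part after the substitution `w = 1 - (1 - r) * y`. -/
noncomputable def blowupIntegrand (α h : ℝ) (g : ℝ → ℝ) (r y : ℝ) : ℝ :=
  y ^ (h - 1) * ((1 + r * y) ^ (h - 1) *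
    ((1 - (1 - r) * y) ^ α * (g (1 - (1 - r) * y) * g (r * (1 - (1 - r) * y)))))

/-- With `w = 1 - (1-r)y`, both `1 - w` and `1 - r w` acquire a factor `1 - r`. Together with `dw`
they yield `(1-r)^(2h-1)`, which the prefactor cancels. -/
theorem rpow_mul_integral_overlapIntegrand_eq {α h r : ℝ} {g : ℝ → ℝ} (hr0 : 0 ≤ r) (hr1 : r < 1) :
    (1 - r) ^ (1 - 2 * h) * ∫ w in (1 / 2 : ℝ)..1, overlapIntegrand α h g r w =
      ∫ y in Set.Ioi 0, (Set.Ioc 0 (1 / 2 / (1 - r))).indicator (blowupIntegrand α h g r) y := by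
  have hε : 0 < 1 - r := sub_pos.2 hr1
  have hsub := intervalIntegral.integral_comp_sub_mul (a := 0) (b := 1 / 2 / (1 - r))
    (overlapIntegrand α h g r) hε.ne' 1
  rw [mul_div_cancel₀ _ hε.ne', mul_zero, sub_zero, smul_eq_mul,
    show (1 : ℝ) - 1 / 2 = 1 / 2 by norm_num] at hsub
  have h0 : (0 : ℝ) ≤ 1 / 2 / (1 - r) := by positivity
  have e : (1 - r) ^ (1 - 2 * h) * ∫ w in (1 / 2 : ℝ)..1, overlapIntegrand α h g r w =
      (1 - r) ^ (2 - 2 * h) * ((1 - r)⁻¹ * ∫ w in (1 / 2 : ℝ)..1, overlapIntegrand α h g r w) := by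
    rw [show 1 - 2 * h = 2 - 2 * h - 1 by ring, Real.rpow_sub_one hε.ne']
    ring
  rw [e, ← hsub, ← intervalIntegral.integral_const_mul, setIntegral_indicator measurableSet_Ioc,
    Set.inter_eq_right.2 Set.Ioc_subset_Ioi_self, intervalIntegral.integral_of_le h0]
  refine setIntegral_congr_fun measurableSet_Ioc fun y hy => ?_
  have e1 : (1 - r) ^ (2 - 2 * h) * (1 - r) ^ (h - 1) * (1 - r) ^ (h - 1) = 1 := by
    rw [← Real.rpow_add hε, ← Real.rpow_add hε]
    ring_nf
    simp
  have e2 : 1 - r * (1 - (1 - r) * y) = (1 - r) * (1 + r * y) := by ring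
  have e3 : 1 - (1 - (1 - r) * y) = (1 - r) * y := by ring
  simp only [overlapIntegrand, blowupIntegrand, e2, e3]
  rw [Real.mul_rpow hε.le hy.1.le, Real.mul_rpow hε.le (by nlinarith [hy.1])]
  linear_combination (y ^ (h - 1) * ((1 + r * y) ^ (h - 1) *
    ((1 - (1 - r) * y) ^ α * (g (1 - (1 - r) * y) * g (r * (1 - (1 - r) * y)))))) * e1

theorem tendsto_rpow_mul_integral_overlapIntegrand_half {α h M : ℝ} {g : ℝ → ℝ} (hα : α ≤ 0)
    (hh : 0 < h) (hh2 : h < 1 / 2) (hg : Continuous g) (hM : ∀ x, |g x| ≤ M) :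
    Filter.Tendsto
      (fun r => (1 - r) ^ (1 - 2 * h) * ∫ w in (1 / 2 : ℝ)..1, overlapIntegrand α h g r w)
      (nhdsWithin 1 (Set.Ico 0 1)) (nhds (∫ y in Set.Ioi 0, blowupIntegrand α h g 1 y)) := by
  have hev : ∀ᶠ r in nhdsWithin (1 : ℝ) (Set.Ico 0 1), r ∈ Set.Ico (1 / 2 : ℝ) 1 := by
    filter_upwards [self_mem_nhdsWithin,
      nhdsWithin_le_nhds (Ioi_mem_nhds (show (1 / 2 : ℝ) < 1 by norm_num))] with r hr hr'
    exact ⟨le_of_lt hr', hr.2⟩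
  refine Filter.Tendsto.congr' (f₁ := fun r => ∫ y in Set.Ioi 0,
    (Set.Ioc 0 (1 / 2 / (1 - r))).indicator (blowupIntegrand α h g r) y) ?_ ?_
  · filter_upwards [self_mem_nhdsWithin] with r hr
    exact (rpow_mul_integral_overlapIntegrand_eq hr.1 hr.2).symm
  -- The bound uses `r ≥ 1/2`, and `w ≥ 1/2` on the support of the indicator, so that `w ^ α ≤ (1/2)
  -- ^ α`.
  refine tendsto_integral_filter_of_dominated_convergence
    (fun y => y ^ (h - 1) * (1 + y / 2) ^ (h - 1) * ((1 / 2) ^ α * (M * M))) ?_ ?_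
    ((integrableOn_rpow_mul_one_add_half_rpow hh hh2).mul_const _) ?_
  · refine Filter.Eventually.of_forall fun r => Measurable.aestronglyMeasurable
      (Measurable.indicator ?_ measurableSet_Ioc)
    have := hg.measurable
    unfold blowupIntegrand
    fun_prop
  · filter_upwards [hev] with r hr
    refine (ae_restrict_iff' measurableSet_Ioi).2 (Filter.Eventually.of_forall fun y hy => ?_)
    have hy0 : 0 < y := hy
    have hM0 : 0 ≤ M := (abs_nonneg _).trans (hM 0)
    have h1 : 0 ≤ y ^ (h - 1) := Real.rpow_nonneg hy0.le _
    have h2 : 0 ≤ (1 + y / 2) ^ (h - 1) := Real.rpow_nonneg (by linarith) _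
    by_cases hy' : y ∈ Set.Ioc 0 (1 / 2 / (1 - r))
    · rw [Set.indicator_of_mem hy']
      have hw : 1 / 2 ≤ 1 - (1 - r) * y := by
        have := (le_div_iff₀ (sub_pos.2 hr.2)).1 hy'.2
        linarith
      have h3 : (1 + r * y) ^ (h - 1) ≤ (1 + y / 2) ^ (h - 1) :=
        Real.rpow_le_rpow_of_nonpos (by linarith) (by nlinarith [hr.1]) (by linarith)
      have h3' : 0 ≤ (1 + r * y) ^ (h - 1) := Real.rpow_nonneg (by nlinarith [hr.1]) _
      have h4 : (1 - (1 - r) * y) ^ α ≤ (1 / 2) ^ α :=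
        Real.rpow_le_rpow_of_nonpos (by norm_num) hw hα
      have h4' : 0 ≤ (1 - (1 - r) * y) ^ α := Real.rpow_nonneg (by linarith) _
      rw [blowupIntegrand, norm_mul, norm_mul, norm_mul (_ ^ α), norm_mul (g _),
        Real.norm_of_nonneg h1, Real.norm_of_nonneg h3', Real.norm_of_nonneg h4',
        Real.norm_eq_abs, Real.norm_eq_abs, mul_assoc (y ^ (h - 1))]
      refine mul_le_mul_of_nonneg_left (mul_le_mul h3 (mul_le_mul h4
        (mul_le_mul (hM _) (hM _) (abs_nonneg _) hM0) (by positivity) (h4'.trans h4))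
        (by positivity) h2) h1
    · rw [Set.indicator_of_notMem hy', norm_zero]
      positivity
  · refine (ae_restrict_iff' measurableSet_Ioi).2 (Filter.Eventually.of_forall fun y hy => ?_)
    have hy0 : 0 < y := hy
    have hcont : ContinuousAt (fun r => blowupIntegrand α h g r y) 1 := by
      unfold blowupIntegrand
      refine continuousAt_const.mul (ContinuousAt.mul ?_ (ContinuousAt.mul ?_ (by fun_prop)))
      · exact ContinuousAt.rpow_const (by fun_prop) (Or.inl (by linarith))
      · exact ContinuousAt.rpow_const (by fun_prop) (Or.inl (by simp))
    refine (hcont.tendsto.mono_left nhdsWithin_le_nhds).congr' ?_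
    have hlim : Filter.Tendsto (fun r : ℝ => (1 - r) * y) (nhds 1) (nhds 0) := by
      have : ContinuousAt (fun r : ℝ => (1 - r) * y) 1 := by fun_prop
      simpa [ContinuousAt] using this
    filter_upwards [self_mem_nhdsWithin, nhdsWithin_le_nhds
      (hlim.eventually_lt_const (show (0 : ℝ) < 1 / 2 by norm_num))] with r hr hr'
    rw [Set.indicator_of_mem]
    refine ⟨hy0, (le_div_iff₀ (sub_pos.2 hr.2)).2 ?_⟩
    linarith

/-- The scale-invariant part of the kernel, normalised by its order of growth at the diagonal,
extends continuously to the diagonal. -/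
theorem exists_continuousOn_eq_overlap {α h M : ℝ} {g : ℝ → ℝ} (hα : -1 < α) (hα0 : α ≤ 0)
    (hh : 0 < h) (hh2 : h < 1 / 2) (hg : Continuous g) (hM : ∀ x, |g x| ≤ M) :
    ∃ f : ℝ → ℝ, ContinuousOn f (Set.Icc 0 1) ∧ ∀ r ∈ Set.Ico (0 : ℝ) 1,
      f r = (1 - r) ^ (1 - 2 * h) * ∫ w in (0 : ℝ)..1, overlapIntegrand α h g r w := by
  -- The formula itself gives `0` at `r = 1`, because `0 ^ (1 - 2h) = 0`; the blow-up limit has to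
  -- be put there by hand.
  refine ⟨Function.update
    (fun r => (1 - r) ^ (1 - 2 * h) * ∫ w in (0 : ℝ)..1, overlapIntegrand α h g r w) 1
    (∫ y in Set.Ioi 0, blowupIntegrand α h g 1 y), ?_, fun r hr => ?_⟩
  swap
  · rw [Function.update_of_ne hr.2.ne]
  have hpow : Continuous fun r : ℝ => (1 - r) ^ (1 - 2 * h) :=
    Continuous.rpow_const (by fun_prop) fun r => Or.inr (by linarith)
  rw [continuousOn_update_iff, Set.Icc_sdiff_right]
  refine ⟨fun r hr => ?_, fun _ => ?_⟩
  · have hρ : (1 + r) / 2 < 1 := by linarith [hr.2]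
    have hc := continuousOn_integral_overlapIntegrand (c := 1) (ρ := (1 + r) / 2) hα hh
      (by linarith) hg hM zero_le_one le_rfl (by linarith) r ⟨hr.1, by linarith [hr.2]⟩
    refine hpow.continuousWithinAt.mul (hc.mono_of_mem_nhdsWithin ?_)
    filter_upwards [self_mem_nhdsWithin, nhdsWithin_le_nhds
      (Iio_mem_nhds (show r < (1 + r) / 2 by linarith [hr.2]))] with x hx hx'
    exact ⟨hx.1, le_of_lt hx'⟩
  -- The part over `[0, 1/2]` stays bounded as `r → 1`, so the vanishing prefactor kills it.
  · have hc := continuousOn_integral_overlapIntegrand (c := 1 / 2) (ρ := 1) hα hh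
      (by linarith) hg hM (by norm_num) (by norm_num) (by norm_num) 1 ⟨zero_le_one, le_rfl⟩
    have h0 : (1 - 1 : ℝ) ^ (1 - 2 * h) = 0 := by
      rw [sub_self, Real.zero_rpow (by linarith)]
    have h1 : Filter.Tendsto
        (fun r => (1 - r) ^ (1 - 2 * h) * ∫ w in (0 : ℝ)..1 / 2, overlapIntegrand α h g r w)
        (nhdsWithin 1 (Set.Ico 0 1)) (nhds 0) := by
      have := (h0 ▸ hpow.continuousWithinAt.tendsto :
        Filter.Tendsto (fun r : ℝ => (1 - r) ^ (1 - 2 * h)) (nhdsWithin 1 (Set.Icc 0 1))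
          (nhds 0)).mul hc.tendsto
      rw [zero_mul] at this
      exact this.mono_left (nhdsWithin_mono 1 Set.Ico_subset_Icc_self)
    have h2 := h1.add (tendsto_rpow_mul_integral_overlapIntegrand_half hα0 hh hh2 hg hM)
    rw [zero_add] at h2
    refine h2.congr' ?_
    filter_upwards [self_mem_nhdsWithin] with r hr
    have hi := intervalIntegrable_overlapIntegrand hα hh hg hr.1 hr.2
    rw [← mul_add, intervalIntegral.integral_add_adjacent_intervals] <;>
      refine hi.mono_set ?_ <;>
      rw [Set.uIcc_of_le (by norm_num), Set.uIcc_of_le zero_le_one]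
    · exact Set.Icc_subset_Icc_right (by norm_num)
    · exact Set.Icc_subset_Icc_left (by norm_num)

/-! ### Factorization of `k` -/

/-- A constant extension beyond `[0,1]` makes continuity and the bound global, as the overlap lemmas
require. -/
theorem exists_continuous_eq_kernelProfile {H₁ H₂ : ℝ} (hH₁ : H₁ < 3 / 2) (hH₂ : 1 / 2 < H₂)
    (hH : H₁ < H₂) : ∃ g : ℝ → ℝ, Continuous g ∧ (∃ M, ∀ x, |g x| ≤ M) ∧
      ∀ r ∈ Set.Icc (0 : ℝ) 1, g r = kernelProfile H₁ H₂ r := by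
  have hc := continuousOn_kernelProfile hH₁ hH₂ hH
  refine ⟨Set.IccExtend zero_le_one ((Set.Icc 0 1).domRestrict (kernelProfile H₁ H₂)),
    (continuousOn_iff_continuous_domRestrict.1 hc).Icc_extend', ?_, fun r hr => ?_⟩
  · obtain ⟨M, hM⟩ := isCompact_Icc.exists_bound_of_continuousOn hc
    exact ⟨M, fun x => hM _ (Set.projIcc (0 : ℝ) 1 zero_le_one x).2⟩
  · rw [Set.IccExtend_of_mem _ _ hr]
    rfl

theorem dBigK_mul_dBigK_rescaled {H₁ H₂ s u w : ℝ} {g : ℝ → ℝ} (hH₁ : H₁ < 3 / 2)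
    (hH₂ : 1 / 2 < H₂) (hH : H₁ < H₂) (hH' : H₂ - H₁ < 1)
    (hg : ∀ r ∈ Set.Icc (0 : ℝ) 1, g r = kernelProfile H₁ H₂ r) (hs : 0 < s) (hsu : s < u)
    (hw : w ∈ Set.Ioo (0 : ℝ) 1) :
    dBigK H₁ H₂ s (s * w) * dBigK H₁ H₂ u (s * w) =
      (betaConst H₂ * (H₂ - H₁)) ^ 2 * (s ^ (-2 * H₁) * u ^ (2 * (H₂ - H₁) - 1)) *
        overlapIntegrand (1 - 2 * H₂) (H₂ - H₁) g (s / u) w := by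
  obtain ⟨hw0, hw1⟩ := hw
  have hu : 0 < u := hs.trans hsu
  have hsw : 0 < s * w := mul_pos hs hw0
  have hsws : s * w < s := mul_lt_of_lt_one_right hs hw1
  have hr0 : 0 < s / u := div_pos hs hu
  have hr1 : s / u < 1 := (div_lt_one hu).2 hsu
  have hrw : s / u * w ≤ 1 := by nlinarith
  rw [dBigK, dBigK, (hasDerivAt_bigK hH₁ hH₂ hH hH' hsw hsws).deriv,
    (hasDerivAt_bigK hH₁ hH₂ hH hH' hsw (hsws.trans hsu)).deriv, overlapIntegrand,
    hg w ⟨hw0.le, hw1.le⟩, hg (s / u * w) ⟨by positivity, hrw⟩, mul_div_cancel_left₀ _ hs.ne',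
    mul_div_right_comm, show s - s * w = s * (1 - w) by ring,
    show u - s * w = u * (1 - s / u * w) by field_simp,
    Real.mul_rpow hs.le hw0.le, Real.mul_rpow hs.le (by linarith),
    Real.mul_rpow hu.le (by linarith)]
  have e1 : w ^ (1 / 2 - H₂) * w ^ (1 / 2 - H₂) = w ^ (1 - 2 * H₂) := by
    rw [← Real.rpow_add hw0]; ring_nf
  have e2 : s ^ (1 / 2 - H₂) * s ^ (1 / 2 - H₂) * s ^ (H₂ - H₁ - 1) * s ^ (H₂ - H₁) =
      s ^ (-2 * H₁) := by
    rw [← Real.rpow_add hs, ← Real.rpow_add hs, ← Real.rpow_add hs]; ring_nf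
  have e3 : u ^ (H₂ - H₁ - 1) * u ^ (H₂ - H₁) = u ^ (2 * (H₂ - H₁) - 1) := by
    rw [← Real.rpow_add hu]; ring_nf
  rw [← e1, ← e2, ← e3]
  ring

theorem intervalIntegrable_dBigK_mul_dBigK {H₁ H₂ s u : ℝ} (hH₁ : H₁ < 3 / 2)
    (hH₂ : 1 / 2 < H₂) (hH₂' : H₂ < 1) (hH : H₁ < H₂) (hH' : H₂ - H₁ < 1)
    (hs : 0 < s) (hsu : s < u) :
    IntervalIntegrable (fun v => dBigK H₁ H₂ s v * dBigK H₁ H₂ u v) volume 0 s := by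
  obtain ⟨g, hgc, -, hg⟩ := exists_continuous_eq_kernelProfile hH₁ hH₂ hH
  have hu : 0 < u := hs.trans hsu
  refine .of_comp_add_mul hs ?_
  refine ((intervalIntegrable_overlapIntegrand (α := 1 - 2 * H₂) (by linarith) (sub_pos.2 hH) hgc
    (div_pos hs hu).le ((div_lt_one hu).2 hsu)).const_mul
    ((betaConst H₂ * (H₂ - H₁)) ^ 2 * (s ^ (-2 * H₁) * u ^ (2 * (H₂ - H₁) - 1)))).congr_uIoo fun w hw => ?_
  rw [Set.uIoo_of_le zero_le_one] at hw
  simp only [zero_add, sub_zero]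
  exact (dBigK_mul_dBigK_rescaled hH₁ hH₂ hH hH' hg hs hsu hw).symm

theorem smallK_eq_of_lt {H₁ H₂ s u : ℝ} {g : ℝ → ℝ} (hH₁ : H₁ < 3 / 2)
    (hH₂ : 1 / 2 < H₂) (hH : H₁ < H₂) (hH' : H₂ - H₁ < 1)
    (hg : ∀ r ∈ Set.Icc (0 : ℝ) 1, g r = kernelProfile H₁ H₂ r) (hs : 0 < s) (hsu : s < u) :
    smallK H₁ H₂ s u = (betaConst H₂ * (H₂ - H₁)) ^ 2 *
      ((1 - s / u) ^ (1 - 2 * (H₂ - H₁)) *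
        ∫ w in (0 : ℝ)..1, overlapIntegrand (1 - 2 * H₂) (H₂ - H₁) g (s / u) w) *
      (s ^ (1 - 2 * H₁) * |s - u| ^ (2 * H₂ - 2 * H₁ - 1)) := by
  have hu : 0 < u := hs.trans hsu
  have hr : 0 < 1 - s / u := sub_pos.2 ((div_lt_one hu).2 hsu)
  have hsub := intervalIntegral.mul_integral_comp_mul_left (a := 0) (b := 1)
    (f := fun v => dBigK H₁ H₂ s v * dBigK H₁ H₂ u v) s
  rw [mul_zero, mul_one] at hsub
  rw [smallK, min_eq_left hsu.le, ← hsub, intervalIntegral.integral_congr_Ioo_of_le zero_le_one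
    fun w hw => dBigK_mul_dBigK_rescaled hH₁ hH₂ hH hH' hg hs hsu hw,
    intervalIntegral.integral_const_mul, abs_sub_comm, abs_of_pos (sub_pos.2 hsu),
    show u - s = u * (1 - s / u) by field_simp, Real.mul_rpow hu.le hr.le]
  have e1 : (1 - s / u) ^ (1 - 2 * (H₂ - H₁)) * (1 - s / u) ^ (2 * H₂ - 2 * H₁ - 1) = 1 := by
    rw [← Real.rpow_add hr]; ring_nf; simp
  have e2 : s * s ^ (-2 * H₁) = s ^ (1 - 2 * H₁) := by
    rw [sub_eq_add_neg, Real.rpow_add hs, Real.rpow_one, neg_mul]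
  rw [← e2, show 2 * (H₂ - H₁) - 1 = 2 * H₂ - 2 * H₁ - 1 by ring]
  linear_combination -((betaConst H₂ * (H₂ - H₁)) ^ 2 * (s * s ^ (-2 * H₁)) *
    u ^ (2 * H₂ - 2 * H₁ - 1) *
    (∫ w in (0 : ℝ)..1, overlapIntegrand (1 - 2 * H₂) (H₂ - H₁) g (s / u) w)) * e1

theorem smallK_comm (H₁ H₂ s u : ℝ) : smallK H₁ H₂ s u = smallK H₁ H₂ u s := by
  rw [smallK, smallK, min_comm]
  simp only [mul_comm]

/-! ### Null sets and the ratio `min/max` -/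

theorem ae_fst_ne_snd : ∀ᵐ p : ℝ × ℝ, p.1 ≠ p.2 := by
  rw [ae_iff, Measure.volume_eq_prod, Measure.measure_prod_null]
  · refine Filter.Eventually.of_forall fun x => ?_
    have : Prod.mk x ⁻¹' {p : ℝ × ℝ | ¬p.1 ≠ p.2} = {x} := by
      ext y; simp [eq_comm]
    exact (congrArg volume this).trans Real.volume_singleton
  · simp only [not_not]
    exact measurableSet_eq_fun measurable_fst measurable_snd

theorem ae_fst_ne_and_snd_ne (c : ℝ) : ∀ᵐ p : ℝ × ℝ, p.1 ≠ c ∧ p.2 ≠ c := by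
  have h : ∀ᵐ x : ℝ, x ≠ c := by simp [ae_iff]
  exact (Measure.quasiMeasurePreserving_fst.ae h).and (Measure.quasiMeasurePreserving_snd.ae h)

theorem continuousOn_min_div_max (T : ℝ) :
    ContinuousOn (fun p : ℝ × ℝ => min p.1 p.2 / max p.1 p.2)
      ((Set.Icc 0 T ×ˢ Set.Icc 0 T) \ {((0 : ℝ), (0 : ℝ))}) := by
  refine ContinuousOn.div (by fun_prop) (by fun_prop) fun p hp h => hp.2 ?_
  have h1 : p.1 ≤ 0 := h ▸ le_max_left _ _
  have h2 : p.2 ≤ 0 := h ▸ le_max_right _ _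
  exact Prod.ext (le_antisymm h1 hp.1.1.1) (le_antisymm h2 hp.1.2.1)

/-- This includes the origin, where `0 / 0 = 0`; hence `κ₀` is bounded there too. -/
theorem min_div_max_mem_Icc {s u : ℝ} (hs : 0 ≤ s) (hu : 0 ≤ u) :
    min s u / max s u ∈ Set.Icc (0 : ℝ) 1 :=
  ⟨div_nonneg (le_min hs hu) (hs.trans (le_max_left _ _)),
    div_le_one_of_le₀ min_le_max (hs.trans (le_max_left _ _))⟩

theorem lemma1 (H₁ H₂ T : ℝ) (hH₁ : 1 / 2 ≤ H₁) (hH₁₂ : H₁ < H₂) (hH₂ : H₂ < 1) (hT : 0 < T) :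
    -- the kernel is given by convergent integrals and genuine derivatives off the axes and diagonal
    (∀ t s : ℝ, 0 < s → s < t → t ≤ T →
      IntervalIntegrable (bigKIntegrand H₁ H₂ t s) volume s t ∧
      DifferentiableAt ℝ (fun x => bigK H₁ H₂ x s) t) ∧
    (∀ s ∈ Set.Ioc 0 T, ∀ u ∈ Set.Ioc 0 T, s ≠ u →
      IntervalIntegrable (fun v => dBigK H₁ H₂ s v * dBigK H₁ H₂ u v) volume 0 (min s u)) ∧
    -- the factorization
    ∃ κ₀ : ℝ → ℝ → ℝ,
      (∃ C : ℝ, ∀ s ∈ Set.Icc 0 T, ∀ u ∈ Set.Icc 0 T, |κ₀ s u| ≤ C) ∧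
      ContinuousOn (fun p : ℝ × ℝ => κ₀ p.1 p.2)
        ((Set.Icc 0 T ×ˢ Set.Icc 0 T) \ {((0 : ℝ), (0 : ℝ))}) ∧
      ∀ᵐ p : ℝ × ℝ ∂(volume.restrict (Set.Icc 0 T ×ˢ Set.Icc 0 T)),
        kappa H₁ H₂ p.1 p.2 =
          if p.1 ≠ p.2 then κ₀ p.1 p.2 * phi H₁ H₂ p.1 p.2 else 0 := by
  have hH₁' : H₁ < 3 / 2 := by linarith
  have hH₂' : 1 / 2 < H₂ := by linarith
  have hh : H₂ - H₁ < 1 := by linarith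
  refine ⟨fun t s hs hst _ => ⟨intervalIntegrable_bigKIntegrand hH₁' hH₂' hs hst,
    (hasDerivAt_bigK hH₁' hH₂' hH₁₂ hh hs hst).differentiableAt⟩, fun s hs u hu hsu => ?_, ?_⟩
  · rcases lt_or_gt_of_ne hsu with h | h
    · rw [min_eq_left h.le]
      exact intervalIntegrable_dBigK_mul_dBigK hH₁' hH₂' hH₂ hH₁₂ hh hs.1 h
    · rw [min_eq_right h.le]
      simpa only [mul_comm] using
        intervalIntegrable_dBigK_mul_dBigK hH₁' hH₂' hH₂ hH₁₂ hh hu.1 h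
  obtain ⟨g, hgc, ⟨M, hM⟩, hg⟩ := exists_continuous_eq_kernelProfile hH₁' hH₂' hH₁₂
  obtain ⟨f, hfc, hf⟩ := exists_continuousOn_eq_overlap (α := 1 - 2 * H₂) (h := H₂ - H₁)
    (by linarith) (by linarith) (sub_pos.2 hH₁₂) (by linarith) hgc hM
  have hFc : ContinuousOn (fun r => (betaConst H₂ * (H₂ - H₁)) ^ 2 * f r) (Set.Icc 0 1) :=
    continuousOn_const.mul hfc
  have hlt : ∀ s u : ℝ, 0 < s → s < u → smallK H₁ H₂ s u =
      (betaConst H₂ * (H₂ - H₁)) ^ 2 * f (s / u) *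
        (s ^ (1 - 2 * H₁) * |s - u| ^ (2 * H₂ - 2 * H₁ - 1)) := fun s u hs hsu => by
    have hu := hs.trans hsu
    rw [smallK_eq_of_lt hH₁' hH₂' hH₁₂ hh hg hs hsu,
      hf _ ⟨(div_pos hs hu).le, (div_lt_one hu).2 hsu⟩]
  refine ⟨fun s u => (betaConst H₂ * (H₂ - H₁)) ^ 2 * f (min s u / max s u), ?_, ?_, ?_⟩
  · obtain ⟨C, hC⟩ := isCompact_Icc.exists_bound_of_continuousOn hFc
    exact ⟨C, fun s hs u hu => hC _ (min_div_max_mem_Icc hs.1 hu.1)⟩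
  · exact hFc.comp (continuousOn_min_div_max T) fun p hp =>
      min_div_max_mem_Icc hp.1.1.1 hp.1.2.1
  -- The diagonal and the axes are null, so only distinct positive `s`, `u` remain.
  · filter_upwards [ae_restrict_mem (measurableSet_Icc.prod measurableSet_Icc),
      ae_restrict_of_ae ae_fst_ne_snd, ae_restrict_of_ae (ae_fst_ne_and_snd_ne 0)]
      with ⟨s, u⟩ hp hsu h0
    have hs : 0 < s := lt_of_le_of_ne hp.1.1 (Ne.symm h0.1)
    have hu : 0 < u := lt_of_le_of_ne hp.2.1 (Ne.symm h0.2)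
    have hsu : s ≠ u := hsu
    simp only [if_pos hsu, kappa, phi]
    rcases lt_or_gt_of_ne hsu with h | h
    · rw [hlt s u hs h, min_eq_left h.le, max_eq_right h.le]
      ring
    · rw [smallK_comm, hlt u s hu h, min_eq_right h.le, max_eq_left h.le, abs_sub_comm u s]
      ring
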